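/- Rings are associative and need not have a unit, and ideals are two-sided. Let $R$ be a ring with local units: for every finite set $F\subseteq R$ there is an idempotent $e\in R$ with $er=re=r$ for all $r\in F$. Let $\alpha:R\to R$ be an injective ring homomorphism with $\alpha(R)R\alpha(R)\subseteq\alpha(R)$. Let $P=\operatorname{span}\{r_1\alpha(r_2): r_1,r_2\in R\}\subseteq R$ be the $R$-bimodule with actions $r\cdot p=rp$ and $p\cdot r=p\,\alpha(r)$, let $Q=\operatorname{span}\{\alpha(r_1)r_2: r_1,r_2\in R\}\subseteq R$ be the $R$-bimodule with actions $r\cdot q=\alpha(r)q$ and $q\cdot r=qr$, and let $\psi:P\otimes_R Q\to R$ be the $R$-bimodule homomorphism $p\otimes q\mapsto pq$. Let $\mathcal O=\mathcal O_{(P,Q,\psi)}(R)$ be the Cuntz–Pimsner ring of $(P,Q,\psi)$ relative to the ideal $R$, with its canonical representation $(S,T,\sigma,\mathcal O)$. That is, $\mathcal O$ is the universal ring generated by the images of additive maps $S:P\to\mathcal O$, $T:Q\to\mathcal O$ and a ring homomorphism $\sigma:R\to\mathcal O$ such that $S(r\cdot p)=\sigma(r)S(p)$, $S(p\cdot r)=S(p)\sigma(r)$,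 $T(r\cdot q)=\sigma(r)T(q)$, $T(q\cdot r)=T(q)\sigma(r)$ and $S(p)T(q)=\sigma(\psi(p\otimes q))$ for all $r\in R$, $p\in P$, $q\in Q$, and such that $\sigma(x)=\sum_{i=1}^n T(q_i)S(p_i)$ whenever $x\in R$, $q_1,\dots,q_n\in Q$ and $p_1,\dots,p_n\in P$ satisfy $x\cdot y=\sum_{i=1}^n q_i\cdot\psi(p_i\otimes y)$ for all $y\in Q$. The ring $\mathcal O$ is $\mathbb Z$-graded, with $\sigma(R)$ in degree $0$, $T(Q)$ in degree $1$ and $S(P)$ in degree $-1$: its component $\mathcal O^{(n)}$ is the additive span of the products of total degree $n$ of elements of these three sets. An ideal $H$ of $\mathcal O$ is graded if $H=\bigoplus_{n\in\mathbb Z}(H\cap\mathcal O^{(n)})$. An ideal $I$ of $R$ is strongly $\alpha$-invariant if $\alpha(I)\subseteq I$ and $\alpha(R)I\alpha(R)\subseteq\alpha(I)$. Then the maps $$H\longmapsto\{x\in R:\sigma(x)\in H\},\qquad I\longmapsto\text{the ideal of }\mathcal O\text{ generated by }\sigma(I)$$ are mutually inverse bijections between the set of graded ideals of $\mathcal O$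 and the set of strongly $\alpha$-invariant ideals of $R$. -/

import Mathlib

open Function

universe u v

/-!
Rings are associative and need not have a unit; ideals are two-sided (`TwoSidedIdeal`).
-/

/-- A ring has local units if every finite subset has a common two-sided idempotent unit. -/
def HasLocalUnits (R : Type u) [NonUnitalRing R] : Prop :=
  ∀ F : Finset R, ∃ e : R, e * e = e ∧ ∀ r ∈ F, e * r = r ∧ r * e = r

/-- An `R`-bimodule structure on the abelian group `M`, for a ring `R` without unit:
`left r m` is `r · m` and `right r m` is `m · r`. -/
structure BimoduleStr (R : Type u) [NonUnitalRing R] (M : Type u) [AddCommGroup M] where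
  left : R →+ M →+ M
  right : R →+ M →+ M
  left_mul : ∀ (r s : R) (m : M), left (r * s) m = left r (left s m)
  right_mul : ∀ (r s : R) (m : M), right (r * s) m = right s (right r m)
  left_right : ∀ (r s : R) (m : M), right s (left r m) = left r (right s m)

/-- An `R`-system `(P, Q, ψ)`: two `R`-bimodules and an `R`-bimodule homomorphism
`ψ : P ⊗_R Q → R`, given as the corresponding `R`-balanced biadditive map `P × Q → R`. -/
structure RSystem (R : Type u) [NonUnitalRing R] (P Q : Type u)
    [AddCommGroup P] [AddCommGroup Q] where
  bimodP : BimoduleStr R P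
  bimodQ : BimoduleStr R Q
  psi : P →+ Q →+ R
  psi_balanced : ∀ (p : P) (r : R) (q : Q), psi (bimodP.right r p) q = psi p (bimodQ.left r q)
  psi_left : ∀ (r : R) (p : P) (q : Q), psi (bimodP.left r p) q = r * psi p q
  psi_right : ∀ (p : P) (q : Q) (r : R), psi p (bimodQ.right r q) = psi p q * r

/-- A covariant representation `(S, T, σ, B)` of an `R`-system. -/
structure CovariantRep {R P Q : Type u} [NonUnitalRing R] [AddCommGroup P] [AddCommGroup Q]
    (X : RSystem R P Q) (B : Type v) [NonUnitalRing B] where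
  S : P →+ B
  T : Q →+ B
  σ : R →ₙ+* B
  S_left : ∀ (r : R) (p : P), S (X.bimodP.left r p) = σ r * S p
  S_right : ∀ (r : R) (p : P), S (X.bimodP.right r p) = S p * σ r
  T_left : ∀ (r : R) (q : Q), T (X.bimodQ.left r q) = σ r * T q
  T_right : ∀ (r : R) (q : Q), T (X.bimodQ.right r q) = T q * σ r
  σ_psi : ∀ (p : P) (q : Q), σ (X.psi p q) = S p * T q

section Quotients

variable {A : Type u} [NonUnitalRing A]

/-- The quotient map from a ring to its quotient by a two-sided ideal. -/
def quotMap (I : TwoSidedIdeal A) : A →ₙ+* I.ringCon.Quotient where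
  toFun a := (a : I.ringCon.Quotient)
  map_mul' _ _ := rfl
  map_zero' := rfl
  map_add' _ _ := rfl

theorem quotMap_eq_iff (I : TwoSidedIdeal A) (a b : A) :
    quotMap I a = quotMap I b ↔ a - b ∈ I :=
  (RingCon.eq I.ringCon).trans (I.rel_iff a b)

end Quotients

namespace RSystem

variable {R P Q : Type u} [NonUnitalRing R] [AddCommGroup P] [AddCommGroup Q]
  (X : RSystem R P Q)

/-- The free (non-unital, associative) ring on the disjoint union of the sets `R`, `P`, `Q`. -/
abbrev FreeRing (_X : RSystem R P Q) : Type u := MonoidAlgebra ℤ (FreeSemigroup (R ⊕ P ⊕ Q))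

/-- The generator of the free ring for `r ∈ R`. -/
noncomputable def genR (r : R) : X.FreeRing := MonoidAlgebra.single (FreeSemigroup.of (Sum.inl r)) 1

/-- The generator of the free ring for `p ∈ P`. -/
noncomputable def genP (p : P) : X.FreeRing :=
  MonoidAlgebra.single (FreeSemigroup.of (Sum.inr (Sum.inl p))) 1

/-- The generator of the free ring for `q ∈ Q`. -/
noncomputable def genQ (q : Q) : X.FreeRing :=
  MonoidAlgebra.single (FreeSemigroup.of (Sum.inr (Sum.inr q))) 1

/-- The relations that make the generators a covariant representation. -/
inductive ToeplitzRel : X.FreeRing → Prop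
  | addR (r s : R) : ToeplitzRel (X.genR (r + s) - (X.genR r + X.genR s))
  | mulR (r s : R) : ToeplitzRel (X.genR (r * s) - X.genR r * X.genR s)
  | addP (p p' : P) : ToeplitzRel (X.genP (p + p') - (X.genP p + X.genP p'))
  | addQ (q q' : Q) : ToeplitzRel (X.genQ (q + q') - (X.genQ q + X.genQ q'))
  | leftP (r : R) (p : P) : ToeplitzRel (X.genP (X.bimodP.left r p) - X.genR r * X.genP p)
  | rightP (r : R) (p : P) : ToeplitzRel (X.genP (X.bimodP.right r p) - X.genP p * X.genR r)
  | leftQ (r : R) (q : Q) : ToeplitzRel (X.genQ (X.bimodQ.left r q) - X.genR r * X.genQ q)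
  | rightQ (r : R) (q : Q) : ToeplitzRel (X.genQ (X.bimodQ.right r q) - X.genQ q * X.genR r)
  | psi (p : P) (q : Q) : ToeplitzRel (X.genR (X.psi p q) - X.genP p * X.genQ q)

/-- The ideal of relations of the Toeplitz ring. -/
noncomputable def toeplitzIdeal : TwoSidedIdeal X.FreeRing :=
  TwoSidedIdeal.span {a | X.ToeplitzRel a}

/-- The Toeplitz ring of `(P, Q, ψ)`: the ring generated by a universal covariant
representation. -/
abbrev ToeplitzRing : Type u := X.toeplitzIdeal.ringCon.Quotient

theorem toeplitz_eq {a b : X.FreeRing} (h : X.ToeplitzRel (a - b)) :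
    quotMap X.toeplitzIdeal a = quotMap X.toeplitzIdeal b :=
  (quotMap_eq_iff _ _ _).2 (TwoSidedIdeal.subset_span h)

/-- The universal covariant representation `(ι_P, ι_Q, ι_R)` in the Toeplitz ring. -/
noncomputable def toeplitzRep : CovariantRep X X.ToeplitzRing where
  S := AddMonoidHom.mk' (fun p => quotMap X.toeplitzIdeal (X.genP p)) fun p p' =>
    (X.toeplitz_eq (.addP p p')).trans (map_add _ _ _)
  T := AddMonoidHom.mk' (fun q => quotMap X.toeplitzIdeal (X.genQ q)) fun q q' =>
    (X.toeplitz_eq (.addQ q q')).trans (map_add _ _ _)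
  σ :=
    { AddMonoidHom.mk' (fun r => quotMap X.toeplitzIdeal (X.genR r)) fun r s =>
        (X.toeplitz_eq (.addR r s)).trans (map_add _ _ _) with
      map_mul' := fun r s => (X.toeplitz_eq (.mulR r s)).trans (map_mul _ _ _) }
  S_left r p := (X.toeplitz_eq (.leftP r p)).trans (map_mul _ _ _)
  S_right r p := (X.toeplitz_eq (.rightP r p)).trans (map_mul _ _ _)
  T_left r q := (X.toeplitz_eq (.leftQ r q)).trans (map_mul _ _ _)
  T_right r q := (X.toeplitz_eq (.rightQ r q)).trans (map_mul _ _ _)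
  σ_psi p q := (X.toeplitz_eq (.psi p q)).trans (map_mul _ _ _)

/-- `X.IsFiniteRankExpansion x n q p` says that the left multiplication `Δ(x) : Q → Q` by `x`
is the finite rank operator `∑ i, θ_{q i, p i}`, where `θ_{q, p}(y) = q · ψ(p ⊗ y)`. -/
def IsFiniteRankExpansion (x : R) (n : ℕ) (q : Fin n → Q) (p : Fin n → P) : Prop :=
  ∀ y : Q, X.bimodQ.left x y = ∑ i, X.bimodQ.right (X.psi (p i) y) (q i)

/-- The ideal of the Toeplitz ring generated by the elements `ι_R(x) - π(Δ(x))`, `x ∈ J`, where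
`π(∑ i, θ_{q i, p i}) = ∑ i, ι_Q(q i) ι_P(p i)`. -/
noncomputable def cuntzPimsnerIdeal (J : TwoSidedIdeal R) : TwoSidedIdeal X.ToeplitzRing :=
  TwoSidedIdeal.span {a | ∃ x ∈ J, ∃ (n : ℕ) (q : Fin n → Q) (p : Fin n → P),
    X.IsFiniteRankExpansion x n q p ∧
      a = X.toeplitzRep.σ x - ∑ i, X.toeplitzRep.T (q i) * X.toeplitzRep.S (p i)}

/-- The Cuntz–Pimsner ring `O_(P,Q,ψ)(J)` of `(P, Q, ψ)` relative to `J`. -/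
abbrev CuntzPimsnerRing (J : TwoSidedIdeal R) : Type u := (X.cuntzPimsnerIdeal J).ringCon.Quotient

end RSystem

/-- The image of a covariant representation under a ring homomorphism. -/
def CovariantRep.map {R P Q : Type u} [NonUnitalRing R] [AddCommGroup P] [AddCommGroup Q]
    {X : RSystem R P Q} {B : Type v} [NonUnitalRing B] {C : Type*} [NonUnitalRing C]
    (ρ : CovariantRep X B) (f : B →ₙ+* C) : CovariantRep X C where
  S := (f : B →+ C).comp ρ.S
  T := (f : B →+ C).comp ρ.T
  σ := f.comp ρ.σ
  S_left r p := by simp [ρ.S_left]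
  S_right r p := by simp [ρ.S_right]
  T_left r q := by simp [ρ.T_left]
  T_right r q := by simp [ρ.T_right]
  σ_psi p q := by simp [ρ.σ_psi]

namespace RSystem

variable {R P Q : Type u} [NonUnitalRing R] [AddCommGroup P] [AddCommGroup Q]
  (X : RSystem R P Q)

/-- The Cuntz–Pimsner representation `(S, T, σ, O_(P,Q,ψ)(J))` of `(P, Q, ψ)` relative to `J`. -/
noncomputable def cuntzPimsnerRep (J : TwoSidedIdeal R) : CovariantRep X (X.CuntzPimsnerRing J) :=
  X.toeplitzRep.map (quotMap (X.cuntzPimsnerIdeal J))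

end RSystem

namespace CovariantRep

variable {R P Q : Type u} [NonUnitalRing R] [AddCommGroup P] [AddCommGroup Q]
  {X : RSystem R P Q} {B : Type v} [NonUnitalRing B] (ρ : CovariantRep X B)

/-- The monomials of degree `n` in the elements `σ(r)` (degree `0`), `T(q)` (degree `1`) and
`S(p)` (degree `-1`). -/
inductive IsMonomial : ℤ → B → Prop
  | σ (r : R) : IsMonomial 0 (ρ.σ r)
  | T (q : Q) : IsMonomial 1 (ρ.T q)
  | S (p : P) : IsMonomial (-1) (ρ.S p)
  | mul {m n : ℤ} {a b : B} : IsMonomial m a → IsMonomial n b → IsMonomial (m + n) (a * b)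

/-- The homogeneous component `B^(n)`. As `S(p) T(q) = σ(ψ(p ⊗ q))`, it is the span of the
elements `T(q₁) ⋯ T(q_k) S(p₁) ⋯ S(p_l)` with `k - l = n` (and of `σ(R)` if `n = 0`). -/
def component (n : ℤ) : AddSubgroup B := AddSubgroup.closure {b | ρ.IsMonomial n b}

/-- An ideal `H` is graded if it is the direct sum of the subgroups `H ∩ B^(n)`, `n ∈ ℤ`. -/
def IsGradedIdeal (H : TwoSidedIdeal B) : Prop :=
  iSupIndep (fun n : ℤ => AddSubgroup.ofClass H ⊓ ρ.component n) ∧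
    ⨆ n : ℤ, AddSubgroup.ofClass H ⊓ ρ.component n = AddSubgroup.ofClass H

end CovariantRep

/-- An ideal `I` of `R` is strongly `α`-invariant if `α(I) ⊆ I` and `α(R) I α(R) ⊆ α(I)`. -/
def IsStronglyInvariant {R : Type u} [NonUnitalRing R] (α : R →ₙ+* R) (I : TwoSidedIdeal R) :
    Prop :=
  (∀ x ∈ I, α x ∈ I) ∧ ∀ r s : R, ∀ x ∈ I, ∃ y ∈ I, α r * x * α s = α y

section EndoSystem

variable {R : Type u} [NonUnitalRing R] (α : R →ₙ+* R)

/-- The underlying group of `P`: the span of `{r₁ α(r₂)}`. -/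
def endoP : AddSubgroup R := AddSubgroup.closure {x | ∃ r s : R, x = r * α s}

/-- The underlying group of `Q`: the span of `{α(r₁) r₂}`. -/
def endoQ : AddSubgroup R := AddSubgroup.closure {x | ∃ r s : R, x = α r * s}

theorem endoP_left (r : R) {p : R} (hp : p ∈ endoP α) : r * p ∈ endoP α := by
  induction hp using AddSubgroup.closure_induction with
  | mem x hx =>
    obtain ⟨a, b, rfl⟩ := hx
    exact AddSubgroup.subset_closure ⟨r * a, b, (mul_assoc _ _ _).symm⟩
  | zero => simp
  | add x y _ _ hx hy => rw [mul_add]; exact add_mem hx hy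
  | neg x _ hx => rw [mul_neg]; exact neg_mem hx

theorem endoP_right (r : R) {p : R} (hp : p ∈ endoP α) : p * α r ∈ endoP α := by
  induction hp using AddSubgroup.closure_induction with
  | mem x hx =>
    obtain ⟨a, b, rfl⟩ := hx
    exact AddSubgroup.subset_closure ⟨a, b * r, by rw [map_mul, mul_assoc]⟩
  | zero => simp
  | add x y _ _ hx hy => rw [add_mul]; exact add_mem hx hy
  | neg x _ hx => rw [neg_mul]; exact neg_mem hx

theorem endoQ_left (r : R) {q : R} (hq : q ∈ endoQ α) : α r * q ∈ endoQ α := by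
  induction hq using AddSubgroup.closure_induction with
  | mem x hx =>
    obtain ⟨a, b, rfl⟩ := hx
    exact AddSubgroup.subset_closure ⟨r * a, b, by rw [map_mul, mul_assoc]⟩
  | zero => simp
  | add x y _ _ hx hy => rw [mul_add]; exact add_mem hx hy
  | neg x _ hx => rw [mul_neg]; exact neg_mem hx

theorem endoQ_right (r : R) {q : R} (hq : q ∈ endoQ α) : q * r ∈ endoQ α := by
  induction hq using AddSubgroup.closure_induction with
  | mem x hx =>
    obtain ⟨a, b, rfl⟩ := hx
    exact AddSubgroup.subset_closure ⟨a, b * r, mul_assoc _ _ _⟩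
  | zero => simp
  | add x y _ _ hx hy => rw [add_mul]; exact add_mem hx hy
  | neg x _ hx => rw [neg_mul]; exact neg_mem hx

/-- The bimodule `P`, with `r · p = r p` and `p · r = p α(r)`. -/
def endoBimodP : BimoduleStr R (endoP α) where
  left := AddMonoidHom.mk' (fun r => AddMonoidHom.mk' (fun p => ⟨r * p, endoP_left α r p.2⟩)
    fun p p' => Subtype.ext (mul_add r p p'))
    fun r s => AddMonoidHom.ext fun p => Subtype.ext (add_mul r s p)
  right := AddMonoidHom.mk' (fun r => AddMonoidHom.mk' (fun p => ⟨p * α r, endoP_right α r p.2⟩)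
    fun p p' => Subtype.ext (add_mul (p : R) p' (α r)))
    fun r s => AddMonoidHom.ext fun p => Subtype.ext (by
      change (p : R) * α (r + s) = p * α r + p * α s
      rw [map_add, mul_add])
  left_mul r s p := Subtype.ext (mul_assoc r s p)
  right_mul r s p := Subtype.ext (by
    change (p : R) * α (r * s) = p * α r * α s
    rw [map_mul, mul_assoc])
  left_right r s p := Subtype.ext (mul_assoc r p (α s))

/-- The bimodule `Q`, with `r · q = α(r) q` and `q · r = q r`. -/
def endoBimodQ : BimoduleStr R (endoQ α) where
  left := AddMonoidHom.mk' (fun r => AddMonoidHom.mk' (fun q => ⟨α r * q, endoQ_left α r q.2⟩)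
    fun q q' => Subtype.ext (mul_add (α r) q q'))
    fun r s => AddMonoidHom.ext fun q => Subtype.ext (by
      change α (r + s) * (q : R) = α r * q + α s * q
      rw [map_add, add_mul])
  right := AddMonoidHom.mk' (fun r => AddMonoidHom.mk' (fun q => ⟨q * r, endoQ_right α r q.2⟩)
    fun q q' => Subtype.ext (add_mul (q : R) q' r))
    fun r s => AddMonoidHom.ext fun q => Subtype.ext (mul_add (q : R) r s)
  left_mul r s q := Subtype.ext (by
    change α (r * s) * (q : R) = α r * (α s * q)
    rw [map_mul, mul_assoc])
  right_mul r s q := Subtype.ext (mul_assoc (q : R) r s).symm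
  left_right r s q := Subtype.ext (mul_assoc (α r) q s)

/-- The `R`-system `(P, Q, ψ)` of the endomorphism `α`, with `ψ(p ⊗ q) = p q`. -/
def endoSystem : RSystem R (endoP α) (endoQ α) where
  bimodP := endoBimodP α
  bimodQ := endoBimodQ α
  psi := AddMonoidHom.mk' (fun p => AddMonoidHom.mk' (fun q => (p : R) * q)
    fun q q' => mul_add (p : R) q q')
    fun p p' => AddMonoidHom.ext fun q => add_mul (p : R) p' q
  psi_balanced p r q := mul_assoc (p : R) (α r) q
  psi_left r p q := mul_assoc r (p : R) q
  psi_right p q r := (mul_assoc (p : R) q r).symm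

/-- The ring `O_(P,Q,ψ)(R)` of the `R`-system of `α`. -/
abbrev EndoCPRing : Type u := (endoSystem α).CuntzPimsnerRing ⊤

/-- The Cuntz–Pimsner representation `(S, T, σ, O_(P,Q,ψ)(R))`. -/
noncomputable def endoCPRep : CovariantRep (endoSystem α) (EndoCPRing α) :=
  (endoSystem α).cuntzPimsnerRep ⊤

end EndoSystem

/-!
The ring `𝒪` behaves like a corner skew Laurent polynomial ring: heuristically `S(p) = p s` and
`T(q) = t q` with `s t = α(1)`, `t s = 1`, `s r = α(r) s` and `t α(r) = r t`.

* The grading. `𝒪` is the sum of its components by construction. They are independent because `𝒪`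
  acts on families indexed by `ℤ` with an element of degree `k` also translating the index by `k`
  (`RSystem.coaction`, `RSystem.iSupIndep_component`). Hence ideals generated in degree zero are
  graded (`CovariantRep.isGradedIdeal_span`).
* Since `α(R) R α(R) ⊆ α(R)`, the Cuntz–Pimsner relations give `T(q) S(p) ∈ σ(R)`, as well as
  `S(p) T(q) ∈ σ(R)`. So every word in the generators reduces to one in which only `T`'s or only
  `S`'s occur, and the component of degree zero is `σ(R)`
  (`exists_eq_σ_of_mem_component_zero`).
* If `e` is a local unit, `σ(e) = T(α(e)) S(α(e))`. So a homogeneous element `h` of an ideal `H`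
  can be moved to degree zero inside `H` and recovered from the result, and a graded ideal `H` is
  generated by its part of degree zero, which lies in `σ(R)` (`span_comap_of_isGradedIdeal`).
* For a strongly invariant ideal `I`, the relations hold for operators on sequences in `R` modulo
  those that are eventually in `I`: `r` acts at the index `m` as the multiplication by `α^m(r)`,
  and `s`, `t` act as the two shifts, which are inverse to each other on such classes
  (`seqRep`). As `α(x) ∈ I` only if `x ∈ I`, the kernel of this representation meets `σ(R)` exactly
  in `σ(I)`, so that `I` is recovered from the ideal generated by `σ(I)`
  (`comap_span_of_isStronglyInvariant`).
-/

/-! ### The universal property of the Cuntz–Pimsner ring -/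

/-- A ring homomorphism vanishing on a two-sided ideal descends to the quotient. -/
def quotLift {A : Type u} [NonUnitalRing A] {B : Type v} [NonUnitalRing B] (I : TwoSidedIdeal A)
    (f : A →ₙ+* B) (hf : I ≤ TwoSidedIdeal.ker f) : I.ringCon.Quotient →ₙ+* B where
  toFun x := Quotient.liftOn x f fun a b h => by
    have h1 := hf ((I.rel_iff a b).1 h)
    rw [TwoSidedIdeal.mem_ker, map_sub] at h1
    exact sub_eq_zero.1 h1
  map_mul' x y := Quotient.inductionOn₂ x y fun a b => map_mul f a b
  map_zero' := map_zero f
  map_add' x y := Quotient.inductionOn₂ x y fun a b => map_add f a b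

theorem quotMap_surjective {A : Type u} [NonUnitalRing A] (I : TwoSidedIdeal A) :
    Surjective (quotMap I) :=
  Quotient.mk_surjective

namespace RSystem

variable {R P Q : Type u} [NonUnitalRing R] [AddCommGroup P] [AddCommGroup Q]
  (X : RSystem R P Q)

/-- The extension of a map on the generators to the free ring. -/
noncomputable def freeLift {B : Type v} [NonUnitalRing B] (g : R ⊕ P ⊕ Q → B) :
    X.FreeRing →ₙ+* B :=
  ((MonoidAlgebra.liftMagma ℤ (FreeSemigroup.lift g) :
    MonoidAlgebra ℤ (FreeSemigroup (R ⊕ P ⊕ Q)) →ₙₐ[ℤ] B) : X.FreeRing →ₙ+* B)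

theorem freeLift_single {B : Type v} [NonUnitalRing B] (g : R ⊕ P ⊕ Q → B) (x : R ⊕ P ⊕ Q) :
    X.freeLift g (MonoidAlgebra.single (FreeSemigroup.of x) 1) = g x := by
  change MonoidAlgebra.liftMagma ℤ (FreeSemigroup.lift g)
    (MonoidAlgebra.single (FreeSemigroup.of x) 1) = g x
  simp [MonoidAlgebra.liftMagma_apply_apply]

variable {X} {B : Type v} [NonUnitalRing B]

/-- The homomorphism from the Toeplitz ring induced by a covariant representation. -/
noncomputable def toeplitzLift (ρ : CovariantRep X B) : X.ToeplitzRing →ₙ+* B :=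
  quotLift X.toeplitzIdeal (X.freeLift (Sum.elim ρ.σ (Sum.elim ρ.S ρ.T))) <| by
    refine TwoSidedIdeal.span_le.2 ?_
    rintro _ (_ | _ | _ | _ | _ | _ | _ | _ | _) <;>
      simp only [SetLike.mem_coe, TwoSidedIdeal.mem_ker, map_sub, map_add, map_mul, genR, genP,
        genQ, freeLift_single, Sum.elim_inl, Sum.elim_inr, ρ.S_left, ρ.S_right, ρ.T_left,
        ρ.T_right, ρ.σ_psi, sub_self]

theorem toeplitzLift_σ (ρ : CovariantRep X B) (r : R) :
    toeplitzLift ρ (X.toeplitzRep.σ r) = ρ.σ r :=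
  X.freeLift_single _ (Sum.inl r)

theorem toeplitzLift_S (ρ : CovariantRep X B) (p : P) :
    toeplitzLift ρ (X.toeplitzRep.S p) = ρ.S p :=
  X.freeLift_single _ (Sum.inr (Sum.inl p))

theorem toeplitzLift_T (ρ : CovariantRep X B) (q : Q) :
    toeplitzLift ρ (X.toeplitzRep.T q) = ρ.T q :=
  X.freeLift_single _ (Sum.inr (Sum.inr q))

/-- The Cuntz–Pimsner relations, relative to the ideal `J`, for a covariant representation. -/
def IsCuntzPimsner (J : TwoSidedIdeal R) (ρ : CovariantRep X B) : Prop :=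
  ∀ x ∈ J, ∀ (n : ℕ) (q : Fin n → Q) (p : Fin n → P), X.IsFiniteRankExpansion x n q p →
    ρ.σ x = ∑ i, ρ.T (q i) * ρ.S (p i)

variable (X) in
theorem isCuntzPimsner_cuntzPimsnerRep (J : TwoSidedIdeal R) :
    IsCuntzPimsner J (X.cuntzPimsnerRep J) := by
  intro x hx n q p h
  have h1 := (quotMap_eq_iff (X.cuntzPimsnerIdeal J) _ _).2
    (TwoSidedIdeal.subset_span ⟨x, hx, n, q, p, h, rfl⟩)
  refine h1.trans ?_
  rw [map_sum]
  simp only [map_mul]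
  rfl

/-- The homomorphism from the Cuntz–Pimsner ring induced by a covariant representation that
satisfies the Cuntz–Pimsner relations. -/
noncomputable def cuntzPimsnerLift {J : TwoSidedIdeal R} (ρ : CovariantRep X B)
    (hρ : IsCuntzPimsner J ρ) : X.CuntzPimsnerRing J →ₙ+* B :=
  quotLift (X.cuntzPimsnerIdeal J) (toeplitzLift ρ) <| by
    refine TwoSidedIdeal.span_le.2 ?_
    rintro _ ⟨x, hx, n, q, p, h, rfl⟩
    simp only [SetLike.mem_coe, TwoSidedIdeal.mem_ker, map_sub, map_sum, map_mul,
      toeplitzLift_σ, toeplitzLift_S, toeplitzLift_T, hρ x hx n q p h, sub_self]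

theorem cuntzPimsnerLift_σ {J : TwoSidedIdeal R} (ρ : CovariantRep X B)
    (hρ : IsCuntzPimsner J ρ) (r : R) :
    cuntzPimsnerLift ρ hρ ((X.cuntzPimsnerRep J).σ r) = ρ.σ r :=
  toeplitzLift_σ ρ r

theorem cuntzPimsnerLift_S {J : TwoSidedIdeal R} (ρ : CovariantRep X B)
    (hρ : IsCuntzPimsner J ρ) (p : P) :
    cuntzPimsnerLift ρ hρ ((X.cuntzPimsnerRep J).S p) = ρ.S p :=
  toeplitzLift_S ρ p

theorem cuntzPimsnerLift_T {J : TwoSidedIdeal R} (ρ : CovariantRep X B)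
    (hρ : IsCuntzPimsner J ρ) (q : Q) :
    cuntzPimsnerLift ρ hρ ((X.cuntzPimsnerRep J).T q) = ρ.T q :=
  toeplitzLift_T ρ q

/-! ### The grading of the Cuntz–Pimsner ring -/

variable (X) in
theorem iSup_component_eq_top (J : TwoSidedIdeal R) :
    ⨆ n : ℤ, (X.cuntzPimsnerRep J).component n = ⊤ := by
  rw [eq_top_iff]
  rintro a -
  obtain ⟨a, rfl⟩ := quotMap_surjective _ a
  obtain ⟨a, rfl⟩ := quotMap_surjective _ a
  have key : ∀ w : FreeSemigroup (R ⊕ P ⊕ Q), ∃ n : ℤ, (X.cuntzPimsnerRep J).IsMonomial n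
      (quotMap (X.cuntzPimsnerIdeal J) (quotMap X.toeplitzIdeal (MonoidAlgebra.single w 1))) := by
    have hgen : ∀ x : R ⊕ P ⊕ Q, ∃ n : ℤ, (X.cuntzPimsnerRep J).IsMonomial n
        (quotMap (X.cuntzPimsnerIdeal J) (quotMap X.toeplitzIdeal
          (MonoidAlgebra.single (FreeSemigroup.of x) 1))) := by
      rintro (r | p | q)
      · exact ⟨_, .σ r⟩
      · exact ⟨_, .S p⟩
      · exact ⟨_, .T q⟩
    intro w
    induction w using FreeSemigroup.recOnMul with
    | ih1 x => exact hgen x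
    | ih2 x y _ hy =>
      obtain ⟨m, hm⟩ := hgen x
      obtain ⟨n, hn⟩ := hy
      refine ⟨m + n, ?_⟩
      have := hm.mul hn
      rwa [← map_mul, ← map_mul, MonoidAlgebra.single_mul_single, one_mul] at this
  induction a using MonoidAlgebra.induction_linear with
  | zero => simp
  | add x y hx hy => simpa using! add_mem hx hy
  | single w k =>
    obtain ⟨n, hn⟩ := key w
    have h1 : (MonoidAlgebra.single w k : X.FreeRing) = k • MonoidAlgebra.single w 1 := by
      simp
    rw [h1, map_zsmul, map_zsmul]
    exact zsmul_mem ((le_iSup (X.cuntzPimsnerRep J).component n)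
      (AddSubgroup.subset_closure hn)) k

/-- The operator `f ↦ (n ↦ a (f (n - k)))` on the group of families indexed by `ℤ`. -/
def translateMul {A : Type u} [NonUnitalRing A] (k : ℤ) : A →+ AddMonoid.End (ℤ → A) :=
  AddMonoidHom.mk' (fun a => AddMonoidHom.mk' (fun f n => a * f (n - k))
    fun f g => funext fun n => mul_add a (f (n - k)) (g (n - k)))
    fun a b => AddMonoidHom.ext fun f => funext fun n => add_mul a b (f (n - k))

theorem translateMul_mul {A : Type u} [NonUnitalRing A] (k l m : ℤ) (h : k + l = m) (a b : A) :
    translateMul k a * translateMul l b = translateMul m (a * b) := by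
  subst h
  refine AddMonoidHom.ext fun f => funext fun n => ?_
  change a * (b * f (n - k - l)) = a * b * f (n - (k + l))
  rw [mul_assoc, sub_sub]

/-- A representation in `B` gives one by operators on `ℤ → B`, in which an element of degree `k`
also translates the index by `k`. -/
def translateRep (ρ : CovariantRep X B) : CovariantRep X (AddMonoid.End (ℤ → B)) where
  S := (translateMul (-1)).comp ρ.S
  T := (translateMul 1).comp ρ.T
  σ := { (translateMul 0).comp (ρ.σ : R →+ B) with
    map_mul' := fun r s => by
      refine Eq.trans ?_ (translateMul_mul 0 0 0 rfl (ρ.σ r) (ρ.σ s)).symm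
      exact congrArg (translateMul 0) (map_mul ρ.σ r s) }
  S_left r p := by
    refine Eq.trans ?_ (translateMul_mul 0 (-1) _ rfl (ρ.σ r) (ρ.S p)).symm
    exact congrArg (translateMul (-1)) (ρ.S_left r p)
  S_right r p := by
    refine Eq.trans ?_ (translateMul_mul (-1) 0 _ rfl (ρ.S p) (ρ.σ r)).symm
    exact congrArg (translateMul (-1)) (ρ.S_right r p)
  T_left r q := by
    refine Eq.trans ?_ (translateMul_mul 0 1 _ rfl (ρ.σ r) (ρ.T q)).symm
    exact congrArg (translateMul 1) (ρ.T_left r q)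
  T_right r q := by
    refine Eq.trans ?_ (translateMul_mul 1 0 _ rfl (ρ.T q) (ρ.σ r)).symm
    exact congrArg (translateMul 1) (ρ.T_right r q)
  σ_psi p q := by
    refine Eq.trans ?_ (translateMul_mul (-1) 1 _ rfl (ρ.S p) (ρ.T q)).symm
    exact congrArg (translateMul 0) (ρ.σ_psi p q)

theorem isCuntzPimsner_translateRep {J : TwoSidedIdeal R} {ρ : CovariantRep X B}
    (hρ : IsCuntzPimsner J ρ) : IsCuntzPimsner J (translateRep ρ) := by
  intro x hx n q p h
  have h1 : (translateRep ρ).σ x = translateMul 0 (∑ i, ρ.T (q i) * ρ.S (p i)) :=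
    congrArg (translateMul 0) (hρ x hx n q p h)
  rw [h1, map_sum]
  exact Finset.sum_congr rfl fun i _ =>
    (translateMul_mul 1 (-1) 0 rfl (ρ.T (q i)) (ρ.S (p i))).symm

variable (X) in
/-- The coaction of `ℤ` on the Cuntz–Pimsner ring that defines its grading, in the form of a
representation by operators on families indexed by `ℤ`. -/
noncomputable def coaction (J : TwoSidedIdeal R) :
    X.CuntzPimsnerRing J →ₙ+* AddMonoid.End (ℤ → X.CuntzPimsnerRing J) :=
  cuntzPimsnerLift (translateRep (X.cuntzPimsnerRep J))
    (isCuntzPimsner_translateRep (X.isCuntzPimsner_cuntzPimsnerRep J))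

theorem coaction_of_mem_component {J : TwoSidedIdeal R} {n : ℤ} {a : X.CuntzPimsnerRing J}
    (ha : a ∈ (X.cuntzPimsnerRep J).component n) : X.coaction J a = translateMul n a := by
  induction ha using AddSubgroup.closure_induction with
  | mem a ha =>
    induction ha with
    | σ r => exact cuntzPimsnerLift_σ _ _ r
    | T q => exact cuntzPimsnerLift_T _ _ q
    | S p => exact cuntzPimsnerLift_S _ _ p
    | mul _ _ h1 h2 => rw [map_mul, h1, h2, translateMul_mul _ _ _ rfl]
  | zero => simp
  | add a b _ _ ha hb => rw [map_add, ha, hb, map_add]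
  | neg a _ ha => rw [map_neg, ha, map_neg]

/-- Evaluating the coaction at families concentrated in one degree separates the homogeneous
components of an element, up to multiplication on the right. -/
theorem iSupIndep_component (J : TwoSidedIdeal R)
    (hunit : ∀ a : X.CuntzPimsnerRing J, ∃ b, a * b = a) :
    iSupIndep (X.cuntzPimsnerRep J).component := by
  rw [iSupIndep_def]
  intro i
  rw [AddSubgroup.disjoint_def]
  intro a hai haj
  obtain ⟨b, hb⟩ := hunit a
  -- the value at `i` of the operator of `a` on the family that is `b` at `0` and `0` elsewhere
  let φ : X.CuntzPimsnerRing J →+ X.CuntzPimsnerRing J :=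
    AddMonoidHom.mk' (fun c => X.coaction J c (Pi.single 0 b) i) fun c d => by
      rw [map_add]; rfl
  have hφ : ∀ n, ∀ c ∈ (X.cuntzPimsnerRep J).component n,
      φ c = c * (Pi.single 0 b : ℤ → X.CuntzPimsnerRing J) (i - n) := fun n c hc => by
    change X.coaction J c (Pi.single 0 b) i = _
    rw [coaction_of_mem_component hc]
    rfl
  have h0 : φ a = 0 := by
    have hle : ⨆ j, ⨆ (_ : j ≠ i), (X.cuntzPimsnerRep J).component j ≤ φ.ker := by
      refine iSup₂_le fun j hj c hc => ?_
      rw [AddMonoidHom.mem_ker, hφ j c hc, Pi.single_eq_of_ne (sub_ne_zero.2 hj.symm), mul_zero]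
    exact hle haj
  rw [hφ i a hai, sub_self, Pi.single_eq_same, hb] at h0
  exact h0

end RSystem

namespace CovariantRep

variable {R P Q : Type u} [NonUnitalRing R] [AddCommGroup P] [AddCommGroup Q]
  {X : RSystem R P Q} {B : Type v} [NonUnitalRing B] (ρ : CovariantRep X B)

theorem mul_mem_component {m n : ℤ} {a b : B} (ha : a ∈ ρ.component m)
    (hb : b ∈ ρ.component n) : a * b ∈ ρ.component (m + n) := by
  induction ha using AddSubgroup.closure_induction with
  | mem a ha =>
    induction hb using AddSubgroup.closure_induction with
    | mem b hb => exact AddSubgroup.subset_closure (ha.mul hb)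
    | zero => simp
    | add b c _ _ hb hc => rw [mul_add]; exact add_mem hb hc
    | neg b _ hb => rw [mul_neg]; exact neg_mem hb
  | zero => simp
  | add a c _ _ ha hc => rw [add_mul]; exact add_mem ha hc
  | neg a _ ha => rw [neg_mul]; exact neg_mem ha

theorem σ_mem_component (r : R) : ρ.σ r ∈ ρ.component 0 :=
  AddSubgroup.subset_closure (.σ r)

theorem T_mem_component (q : Q) : ρ.T q ∈ ρ.component 1 :=
  AddSubgroup.subset_closure (.T q)

theorem S_mem_component (p : P) : ρ.S p ∈ ρ.component (-1) :=
  AddSubgroup.subset_closure (.S p)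

/-- An ideal generated by elements of degree `0` is graded, in a graded ring. -/
theorem isGradedIdeal_span (hind : iSupIndep ρ.component) (htop : ⨆ n, ρ.component n = ⊤)
    {s : Set B} (hs : s ⊆ ρ.component 0) : ρ.IsGradedIdeal (TwoSidedIdeal.span s) := by
  set H := TwoSidedIdeal.span s
  refine ⟨hind.mono fun n => inf_le_right, le_antisymm (iSup_le fun n => inf_le_left) ?_⟩
  set K := ⨆ n : ℤ, AddSubgroup.ofClass H ⊓ ρ.component n
  have hleft : ∀ {a b : B}, b ∈ K → a * b ∈ K := by
    intro a b hb
    have ha : a ∈ ⨆ n, ρ.component n := htop ▸ AddSubgroup.mem_top a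
    induction ha using AddSubgroup.iSup_induction' with
    | hp m a ha =>
      induction hb using AddSubgroup.iSup_induction' with
      | hp n b hb =>
        exact AddSubgroup.mem_iSup_of_mem (m + n)
          ⟨H.mul_mem_left _ _ hb.1, ρ.mul_mem_component ha hb.2⟩
      | h1 => rw [mul_zero]; exact zero_mem K
      | hadd b c _ _ hb hc => rw [mul_add]; exact add_mem hb hc
    | h1 => rw [zero_mul]; exact zero_mem K
    | hadd a c _ _ ha hc => rw [add_mul]; exact add_mem ha hc
  have hright : ∀ {b a : B}, b ∈ K → b * a ∈ K := by
    intro b a hb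
    have ha : a ∈ ⨆ n, ρ.component n := htop ▸ AddSubgroup.mem_top a
    induction ha using AddSubgroup.iSup_induction' with
    | hp m a ha =>
      induction hb using AddSubgroup.iSup_induction' with
      | hp n b hb =>
        exact AddSubgroup.mem_iSup_of_mem (n + m)
          ⟨H.mul_mem_right _ _ hb.1, ρ.mul_mem_component hb.2 ha⟩
      | h1 => rw [zero_mul]; exact zero_mem K
      | hadd b c _ _ hb hc => rw [add_mul]; exact add_mem hb hc
    | h1 => rw [mul_zero]; exact zero_mem K
    | hadd a c _ _ ha hc => rw [mul_add]; exact add_mem ha hc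
  have hle : H ≤ TwoSidedIdeal.mk' (K : Set B) K.zero_mem K.add_mem K.neg_mem hleft hright :=
    TwoSidedIdeal.span_le.2 fun x hx => (TwoSidedIdeal.mem_mk' _ _ _ _ _ _ _).2
      (AddSubgroup.mem_iSup_of_mem 0 ⟨TwoSidedIdeal.subset_span hx, hs hx⟩)
  exact fun x hx => (TwoSidedIdeal.mem_mk' _ _ _ _ _ _ _).1 (hle hx)

end CovariantRep

section EndoSystem

variable {R : Type u} [NonUnitalRing R] {α : R →ₙ+* R}

/-! ### Local units in representations of the system of an endomorphism -/

theorem HasLocalUnits.exists_unit (hR : HasLocalUnits R) (x y : R) :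
    ∃ e : R, e * e = e ∧ (e * x = x ∧ x * e = x) ∧ (e * y = y ∧ y * e = y) := by
  classical
  obtain ⟨e, he, h⟩ := hR {x, y}
  exact ⟨e, he, h x (by simp), h y (by simp)⟩

theorem endoP_exists_unit (hR : HasLocalUnits R) {p : R} (hp : p ∈ endoP α) :
    ∃ c : R, ∀ e, c * e = c → p * α e = p := by
  induction hp using AddSubgroup.closure_induction with
  | mem x hx =>
    obtain ⟨r, s, rfl⟩ := hx
    exact ⟨s, fun e he => by rw [mul_assoc, ← map_mul, he]⟩
  | zero => exact ⟨0, fun e _ => zero_mul _⟩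
  | add x y _ _ hx hy =>
    obtain ⟨c, hc⟩ := hx
    obtain ⟨d, hd⟩ := hy
    obtain ⟨f, -, ⟨-, hf⟩, -, hf'⟩ := hR.exists_unit c d
    refine ⟨f, fun e he => ?_⟩
    rw [add_mul, hc e (by rw [← hf, mul_assoc, he]), hd e (by rw [← hf', mul_assoc, he])]
  | neg x _ hx =>
    obtain ⟨c, hc⟩ := hx
    exact ⟨c, fun e he => by rw [neg_mul, hc e he]⟩

theorem endoQ_exists_unit (hR : HasLocalUnits R) {q : R} (hq : q ∈ endoQ α) :
    ∃ c : R, ∀ e, e * c = c → α e * q = q := by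
  induction hq using AddSubgroup.closure_induction with
  | mem x hx =>
    obtain ⟨r, s, rfl⟩ := hx
    exact ⟨r, fun e he => by rw [← mul_assoc, ← map_mul, he]⟩
  | zero => exact ⟨0, fun e _ => mul_zero _⟩
  | add x y _ _ hx hy =>
    obtain ⟨c, hc⟩ := hx
    obtain ⟨d, hd⟩ := hy
    obtain ⟨f, -, ⟨hf, -⟩, hf', -⟩ := hR.exists_unit c d
    refine ⟨f, fun e he => ?_⟩
    rw [mul_add, hc e (by rw [← hf, ← mul_assoc, he]), hd e (by rw [← hf', ← mul_assoc, he])]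
  | neg x _ hx =>
    obtain ⟨c, hc⟩ := hx
    exact ⟨c, fun e he => by rw [mul_neg, hc e he]⟩

variable {B : Type v} [NonUnitalRing B] {ρ : CovariantRep (endoSystem α) B}

theorem endoRep_S_left (r : R) (p : endoP α) :
    ρ.S ⟨r * p, endoP_left α r p.2⟩ = ρ.σ r * ρ.S p :=
  ρ.S_left r p

theorem endoRep_S_right (r : R) (p : endoP α) :
    ρ.S ⟨p * α r, endoP_right α r p.2⟩ = ρ.S p * ρ.σ r :=
  ρ.S_right r p

theorem endoRep_T_left (r : R) (q : endoQ α) :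
    ρ.T ⟨α r * q, endoQ_left α r q.2⟩ = ρ.σ r * ρ.T q :=
  ρ.T_left r q

theorem endoRep_T_right (r : R) (q : endoQ α) :
    ρ.T ⟨q * r, endoQ_right α r q.2⟩ = ρ.T q * ρ.σ r :=
  ρ.T_right r q

theorem endoRep_S_mul_T (p : endoP α) (q : endoQ α) :
    ρ.S p * ρ.T q = ρ.σ (p * q) :=
  (ρ.σ_psi p q).symm

/-- The Cuntz–Pimsner relation for an operator `θ_{q, p}` of rank one. -/
theorem endoRep_T_mul_S (hρ : RSystem.IsCuntzPimsner ⊤ ρ) {p : endoP α} {q : endoQ α} {y : R}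
    (h : (q : R) * p = α y) :
    ρ.T q * ρ.S p = ρ.σ y := by
  have h1 := hρ y trivial 1 (fun _ => q)
    (fun _ => p) fun z => by
      rw [Fin.sum_univ_one]
      refine Subtype.ext ?_
      change α y * (z : R) = q * (p * z)
      rw [← h, mul_assoc]
  rw [Fin.sum_univ_one] at h1
  exact h1.symm

/-- If `B` is generated by the representation, every element of `B` is fixed by the
images of all large enough local units of `R`. -/
theorem endoRep_exists_unit (hR : HasLocalUnits R)
    (htop : ⨆ n, ρ.component n = ⊤) (a : B) :
    ∃ c : R, ∀ e, e * c = c → c * e = c →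
      ρ.σ e * a = a ∧ a * ρ.σ e = a := by
  have ha : a ∈ ⨆ n, ρ.component n :=
    htop.symm ▸ AddSubgroup.mem_top a
  have hadd : ∀ a b : B,
      (∃ c : R, ∀ e, e * c = c → c * e = c →
        ρ.σ e * a = a ∧ a * ρ.σ e = a) →
      (∃ c : R, ∀ e, e * c = c → c * e = c →
        ρ.σ e * b = b ∧ b * ρ.σ e = b) →
      ∃ c : R, ∀ e, e * c = c → c * e = c →
        (ρ.σ e * a = a ∧ a * ρ.σ e = a) ∧
        (ρ.σ e * b = b ∧ b * ρ.σ e = b) := by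
    rintro a b ⟨c, hc⟩ ⟨d, hd⟩
    obtain ⟨f, -, ⟨h1, h2⟩, h3, h4⟩ := hR.exists_unit c d
    exact ⟨f, fun e he he' =>
      ⟨hc e (by rw [← h1, ← mul_assoc, he]) (by rw [← h2, mul_assoc, he']),
      hd e (by rw [← h3, ← mul_assoc, he]) (by rw [← h4, mul_assoc, he'])⟩⟩
  induction ha using AddSubgroup.iSup_induction' with
  | hp n a ha =>
    induction ha using AddSubgroup.closure_induction with
    | mem a ha =>
      induction ha with
      | σ r => exact ⟨r, fun e he he' => by rw [← map_mul, ← map_mul, he, he']; exact ⟨rfl, rfl⟩⟩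
      | T q =>
        obtain ⟨c, hc⟩ := endoQ_exists_unit hR q.2
        obtain ⟨f, -, ⟨h1, -⟩, -, h2⟩ := hR.exists_unit c (q : R)
        refine ⟨f, fun e he he' => ?_⟩
        rw [← endoRep_T_left, ← endoRep_T_right]
        exact ⟨congrArg _ (Subtype.ext (hc e (by rw [← h1, ← mul_assoc, he]))),
          congrArg _ (Subtype.ext (by
            change (q : R) * e = q
            rw [← h2, mul_assoc, he']))⟩
      | S p =>
        obtain ⟨c, hc⟩ := endoP_exists_unit hR p.2
        obtain ⟨f, -, ⟨-, h1⟩, h2, -⟩ := hR.exists_unit c (p : R)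
        refine ⟨f, fun e he he' => ?_⟩
        rw [← endoRep_S_left, ← endoRep_S_right]
        exact ⟨congrArg _ (Subtype.ext (by
            change e * (p : R) = p
            rw [← h2, ← mul_assoc, he])),
          congrArg _ (Subtype.ext (hc e (by rw [← h1, mul_assoc, he'])))⟩
      | mul _ _ ha hb =>
        obtain ⟨c, hc⟩ := hadd _ _ ha hb
        refine ⟨c, fun e he he' => ?_⟩
        rw [← mul_assoc, (hc e he he').1.1, mul_assoc, (hc e he he').2.2]
        exact ⟨rfl, rfl⟩
    | zero => exact ⟨0, fun e _ _ => ⟨mul_zero _, zero_mul _⟩⟩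
    | add a b _ _ ha hb =>
      obtain ⟨c, hc⟩ := hadd _ _ ha hb
      refine ⟨c, fun e he he' => ?_⟩
      rw [mul_add, add_mul, (hc e he he').1.1, (hc e he he').2.1, (hc e he he').1.2,
        (hc e he he').2.2]
      exact ⟨rfl, rfl⟩
    | neg a _ ha =>
      obtain ⟨c, hc⟩ := ha
      refine ⟨c, fun e he he' => ?_⟩
      rw [mul_neg, neg_mul, (hc e he he').1, (hc e he he').2]
      exact ⟨rfl, rfl⟩
  | h1 => exact ⟨0, fun e _ _ => ⟨mul_zero _, zero_mul _⟩⟩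
  | hadd a b _ _ ha hb =>
    obtain ⟨c, hc⟩ := hadd _ _ ha hb
    refine ⟨c, fun e he he' => ?_⟩
    rw [mul_add, add_mul, (hc e he he').1.1, (hc e he he').2.1, (hc e he he').1.2,
      (hc e he he').2.2]
    exact ⟨rfl, rfl⟩

theorem endoRep_exists_idempotent (hR : HasLocalUnits R)
    (htop : ⨆ n, ρ.component n = ⊤) (a : B) :
    ∃ e : R, e * e = e ∧ ρ.σ e * a = a ∧ a * ρ.σ e = a := by
  obtain ⟨c, hc⟩ := endoRep_exists_unit hR htop a
  obtain ⟨e, he, ⟨h1, h2⟩, -⟩ := hR.exists_unit c c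
  exact ⟨e, he, hc e h1 h2⟩

/-! ### The component of degree zero -/

/-- Products of elements `q ∈ Q` and `p ∈ P` lie in the corner `α(R)`. -/
theorem endoQ_mul_endoP (hcorner : ∀ r s t : R, ∃ y : R, α r * s * α t = α y) {q p : R}
    (hq : q ∈ endoQ α) (hp : p ∈ endoP α) : ∃ y, q * p = α y := by
  induction hq using AddSubgroup.closure_induction with
  | mem x hx =>
    obtain ⟨a, b, rfl⟩ := hx
    induction hp using AddSubgroup.closure_induction with
    | mem x hx =>
      obtain ⟨c, d, rfl⟩ := hx
      obtain ⟨y, hy⟩ := hcorner a (b * c) d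
      exact ⟨y, by rw [← hy]; simp only [mul_assoc]⟩
    | zero => exact ⟨0, by simp⟩
    | add x z _ _ hx hz =>
      obtain ⟨y, hy⟩ := hx
      obtain ⟨w, hw⟩ := hz
      exact ⟨y + w, by rw [mul_add, hy, hw, map_add]⟩
    | neg x _ hx =>
      obtain ⟨y, hy⟩ := hx
      exact ⟨-y, by rw [mul_neg, hy, map_neg]⟩
  | zero => exact ⟨0, by simp⟩
  | add x z _ _ hx hz =>
    obtain ⟨y, hy⟩ := hx
    obtain ⟨w, hw⟩ := hz
    exact ⟨y + w, by rw [add_mul, hy, hw, map_add]⟩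
  | neg x _ hx =>
    obtain ⟨y, hy⟩ := hx
    exact ⟨-y, by rw [neg_mul, hy, map_neg]⟩

variable (ρ) in
/-- The reduced products of degree `n`, written from right to left: `σ(r)`, multiplied on the
left by elements of `T(Q)` only (for `n ≥ 0`) or by elements of `S(P)` only (for `n ≤ 0`). -/
inductive IsReducedProduct : ℤ → B → Prop
  | σ (r : R) : IsReducedProduct 0 (ρ.σ r)
  | T {n : ℤ} {b : B} (q : endoQ α) (hn : 0 ≤ n) :
      IsReducedProduct n b → IsReducedProduct (n + 1) (ρ.T q * b)
  | S {n : ℤ} {b : B} (p : endoP α) (hn : n ≤ 0) :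
      IsReducedProduct n b → IsReducedProduct (n - 1) (ρ.S p * b)

namespace IsReducedProduct

theorem σ_mul {n : ℤ} {b : B} (hb : IsReducedProduct ρ n b) (r : R) :
    IsReducedProduct ρ n (ρ.σ r * b) := by
  cases hb with
  | σ s => rw [← map_mul]; exact .σ _
  | T q hn hb => rw [← mul_assoc, ← endoRep_T_left]; exact .T _ hn hb
  | S p hn hb => rw [← mul_assoc, ← endoRep_S_left]; exact .S _ hn hb

theorem T_mul (hρ : RSystem.IsCuntzPimsner ⊤ ρ)
    (hcorner : ∀ r s t : R, ∃ y : R, α r * s * α t = α y) {n : ℤ}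
    {b : B} (hb : IsReducedProduct ρ n b) (q : endoQ α) :
    IsReducedProduct ρ (n + 1) (ρ.T q * b) := by
  cases hb with
  | σ s => exact .T q le_rfl (.σ s)
  | T q' hn hb => exact .T q (by lia) (.T q' hn hb)
  | S p hn hb =>
    obtain ⟨y, hy⟩ := endoQ_mul_endoP hcorner q.2 p.2
    rw [← mul_assoc, endoRep_T_mul_S hρ hy, sub_add_cancel]
    exact hb.σ_mul y

theorem S_mul {n : ℤ} {b : B} (hb : IsReducedProduct ρ n b) (p : endoP α) :
    IsReducedProduct ρ (n - 1) (ρ.S p * b) := by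
  cases hb with
  | σ s => exact .S p le_rfl (.σ s)
  | T q hn hb =>
    rw [← mul_assoc, endoRep_S_mul_T, add_sub_cancel_right]
    exact hb.σ_mul _
  | S p' hn hb => exact .S p (by lia) (.S p' hn hb)

theorem monomial_mul (hρ : RSystem.IsCuntzPimsner ⊤ ρ)
    (hcorner : ∀ r s t : R, ∃ y : R, α r * s * α t = α y) {m n : ℤ}
    {a b : B} (ha : ρ.IsMonomial m a) (hb : IsReducedProduct ρ n b) :
    IsReducedProduct ρ (m + n) (a * b) := by
  induction ha generalizing n b with
  | σ r => rw [zero_add]; exact hb.σ_mul r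
  | T q => rw [add_comm]; exact hb.T_mul hρ hcorner q
  | S p => rw [neg_add_eq_sub]; exact hb.S_mul p
  | mul _ _ h1 h2 => rw [mul_assoc, add_assoc]; exact h1 (h2 hb)

theorem exists_eq_σ {b : B} (hb : IsReducedProduct ρ 0 b) :
    ∃ r, b = ρ.σ r := by
  generalize hn : (0 : ℤ) = n at hb
  cases hb with
  | σ r => exact ⟨r, rfl⟩
  | T q h _ => lia
  | S p h _ => lia

end IsReducedProduct

/-- The component of degree zero of `B` is the image of `R`. -/
theorem exists_eq_σ_of_mem_component_zero (hR : HasLocalUnits R)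
    (hρ : RSystem.IsCuntzPimsner ⊤ ρ) (htop : ⨆ n, ρ.component n = ⊤)
    (hcorner : ∀ r s t : R, ∃ y : R, α r * s * α t = α y) {a : B}
    (ha : a ∈ ρ.component 0) : ∃ r, a = ρ.σ r := by
  induction ha using AddSubgroup.closure_induction with
  | mem a ha =>
    obtain ⟨e, -, -, h⟩ := endoRep_exists_idempotent hR htop a
    have h1 := IsReducedProduct.monomial_mul hρ hcorner ha (.σ e)
    rw [h, add_zero] at h1
    exact h1.exists_eq_σ
  | zero => exact ⟨0, (map_zero _).symm⟩
  | add a b _ _ ha hb =>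
    obtain ⟨r, rfl⟩ := ha
    obtain ⟨s, rfl⟩ := hb
    exact ⟨r + s, (map_add _ _ _).symm⟩
  | neg a _ ha =>
    obtain ⟨r, rfl⟩ := ha
    exact ⟨-r, (map_neg _ _).symm⟩

/-! ### Graded ideals are generated in degree zero -/

theorem exists_T_mul_S_eq_σ (hρ : RSystem.IsCuntzPimsner ⊤ ρ) {e : R} (he : e * e = e) :
    ∃ (q : endoQ α) (p : endoP α), (q : R) = α e ∧ (p : R) = α e ∧
      ρ.T q * ρ.S p = ρ.σ e := by
  have h : α e = α e * α e := by rw [← map_mul, he]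
  exact ⟨⟨α e, AddSubgroup.subset_closure ⟨e, α e, h⟩⟩,
    ⟨α e, AddSubgroup.subset_closure ⟨α e, e, h⟩⟩, rfl, rfl, endoRep_T_mul_S hρ h.symm⟩

/-- With `e` a unit for `x`, `α(x) = α(e) α(x) α(e)` gives `σ(α(x)) = S(α(e)) σ(x) T(α(e))`, and
`α(r) x α(s) = α(y)` gives `T(α(r) f) σ(x) S(f α(s)) = σ(y)` for a suitable local unit `f`. -/
theorem isStronglyInvariant_comap (hR : HasLocalUnits R)
    (hρ : RSystem.IsCuntzPimsner ⊤ ρ)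
    (hcorner : ∀ r s t : R, ∃ y : R, α r * s * α t = α y) (H : TwoSidedIdeal B) :
    IsStronglyInvariant α (TwoSidedIdeal.comap ρ.σ H) := by
  constructor
  · intro x hx
    rw [TwoSidedIdeal.mem_comap] at hx ⊢
    obtain ⟨e, he, ⟨h1, h2⟩, -⟩ := hR.exists_unit x x
    obtain ⟨q, p, hq, hp, -⟩ := exists_T_mul_S_eq_σ hρ he
    have h3 : ρ.S p * ρ.σ x * ρ.T q = ρ.σ (α x) := by
      rw [← endoRep_S_right, endoRep_S_mul_T]
      simp only [hq, hp, ← map_mul, h1, h2]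
    rw [← h3]
    exact H.mul_mem_right _ _ (H.mul_mem_left _ _ hx)
  · intro r s x hx
    obtain ⟨y, hy⟩ := hcorner r x s
    refine ⟨y, ?_, hy⟩
    rw [TwoSidedIdeal.mem_comap] at hx ⊢
    obtain ⟨f, -, ⟨-, h5⟩, h6, -⟩ := hR.exists_unit (α r) (α s)
    let q : endoQ α := ⟨α r * f, AddSubgroup.subset_closure ⟨r, f, rfl⟩⟩
    let p : endoP α := ⟨f * α s, AddSubgroup.subset_closure ⟨f, s, rfl⟩⟩
    have h8 : ρ.T q * ρ.σ x * ρ.S p = ρ.σ y := by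
      rw [← endoRep_T_right]
      refine endoRep_T_mul_S hρ ?_
      change α r * f * x * (f * α s) = α y
      rw [h5, h6, hy]
    rw [← h8]
    exact H.mul_mem_right _ _ (H.mul_mem_left _ _ hx)

/-- A homogeneous element `h ∈ H` of degree `n > 0` factors as `T(q) S(p) h` with `S(p) h ∈ H` of
degree `n - 1`, and one of degree `n < 0` as `h T(q) S(p)` with `h T(q) ∈ H` of degree `n + 1`;
so `h` lies in the ideal generated by elements of `H` of degree zero. -/
theorem mem_span_of_mem_component (hR : HasLocalUnits R)
    (hρ : RSystem.IsCuntzPimsner ⊤ ρ) (htop : ⨆ n, ρ.component n = ⊤)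
    (hcorner : ∀ r s t : R, ∃ y : R, α r * s * α t = α y) (H : TwoSidedIdeal B)
    (n : ℤ) {a : B} (haH : a ∈ H) (ha : a ∈ ρ.component n) :
    a ∈ TwoSidedIdeal.span
      (ρ.σ '' (TwoSidedIdeal.comap ρ.σ H : Set R)) := by
  induction n generalizing a with
  | zero =>
    obtain ⟨r, rfl⟩ := exists_eq_σ_of_mem_component_zero hR hρ htop hcorner ha
    exact TwoSidedIdeal.subset_span ⟨r, (TwoSidedIdeal.mem_comap ρ.σ).2 haH, rfl⟩
  | succ n ih =>
    obtain ⟨e, he, h, -⟩ := endoRep_exists_idempotent hR htop a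
    obtain ⟨q, p, -, -, hqp⟩ := exists_T_mul_S_eq_σ hρ he
    rw [← h, ← hqp, mul_assoc]
    refine TwoSidedIdeal.mul_mem_left _ _ _ (ih (H.mul_mem_left _ _ haH) ?_)
    have := ρ.mul_mem_component (ρ.S_mem_component p) ha
    rwa [neg_add_cancel_comm_assoc] at this
  | pred n ih =>
    obtain ⟨e, he, -, h⟩ := endoRep_exists_idempotent hR htop a
    obtain ⟨q, p, -, -, hqp⟩ := exists_T_mul_S_eq_σ hρ he
    rw [← h, ← hqp, ← mul_assoc]
    refine TwoSidedIdeal.mul_mem_right _ _ _ (ih (H.mul_mem_right _ _ haH) ?_)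
    have := ρ.mul_mem_component ha (ρ.T_mem_component q)
    rwa [sub_add_cancel] at this

theorem span_comap_of_isGradedIdeal (hR : HasLocalUnits R)
    (hρ : RSystem.IsCuntzPimsner ⊤ ρ) (htop : ⨆ n, ρ.component n = ⊤)
    (hcorner : ∀ r s t : R, ∃ y : R, α r * s * α t = α y) {H : TwoSidedIdeal B}
    (hH : ρ.IsGradedIdeal H) :
    TwoSidedIdeal.span
      (ρ.σ '' (TwoSidedIdeal.comap ρ.σ H : Set R)) = H := by
  refine le_antisymm (TwoSidedIdeal.span_le.2 ?_) fun a ha => ?_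
  · rintro _ ⟨x, hx, rfl⟩
    exact (TwoSidedIdeal.mem_comap ρ.σ).1 hx
  · have h1 : a ∈ ⨆ n : ℤ, AddSubgroup.ofClass H ⊓ ρ.component n := by
      rw [hH.2]; exact ha
    induction h1 using AddSubgroup.iSup_induction' with
    | hp n b hb => exact mem_span_of_mem_component hR hρ htop hcorner H n hb.1 hb.2
    | h1 => exact zero_mem _
    | hadd b c hb hc h1 h2 =>
      have hle : ⨆ n : ℤ, AddSubgroup.ofClass H ⊓ ρ.component n
          ≤ AddSubgroup.ofClass H := iSup_le fun n => inf_le_left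
      exact add_mem (h1 (hle hb)) (h2 (hle hc))

/-! ### Representations on sequences modulo an invariant ideal -/

open Filter

variable (I : TwoSidedIdeal R)

/-- The sequences in `R` whose terms eventually lie in `I`. -/
def eventuallyIn : AddSubgroup (ℕ → R) where
  carrier := {f | ∀ᶠ m in atTop, f m ∈ I}
  zero_mem' := Eventually.of_forall fun _ => I.zero_mem
  add_mem' hf hg := by
    filter_upwards [hf, hg] with m h1 h2 using I.add_mem h1 h2
  neg_mem' hf := by
    filter_upwards [hf] with m h using I.neg_mem h

/-- The operator `f ↦ (m ↦ a m * f (g m))` on sequences in `R` modulo those that are eventually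
in `I`, for a reindexing `g` that tends to infinity. -/
def seqOp (g : ℕ → ℕ) (hg : Tendsto g atTop atTop) (a : ℕ → R) :
    AddMonoid.End ((ℕ → R) ⧸ eventuallyIn I) :=
  QuotientAddGroup.map (eventuallyIn I) (eventuallyIn I)
    (AddMonoidHom.mk' (fun f m => a m * f (g m)) fun f f' => funext fun m =>
      mul_add (a m) (f (g m)) (f' (g m)))
    fun f hf => by
      change ∀ᶠ m in atTop, a m * f (g m) ∈ I
      filter_upwards [hg.eventually hf] with m h using I.mul_mem_left _ _ h

theorem seqOp_mk {g : ℕ → ℕ} (hg : Tendsto g atTop atTop) (a f : ℕ → R) :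
    seqOp I g hg a (QuotientAddGroup.mk (s := eventuallyIn I) f) =
      QuotientAddGroup.mk (s := eventuallyIn I) (fun m => a m * f (g m)) :=
  rfl

variable {I} in
theorem seqEnd_ext {φ χ : AddMonoid.End ((ℕ → R) ⧸ eventuallyIn I)}
    (h : ∀ f : ℕ → R, φ (QuotientAddGroup.mk (s := eventuallyIn I) f) =
      χ (QuotientAddGroup.mk (s := eventuallyIn I) f)) : φ = χ :=
  AddMonoidHom.ext fun f => by
    induction f using QuotientAddGroup.induction_on with
    | H f => exact h f

theorem seqOp_add {g : ℕ → ℕ} (hg : Tendsto g atTop atTop) (a b : ℕ → R) :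
    seqOp I g hg (a + b) = seqOp I g hg a + seqOp I g hg b :=
  seqEnd_ext fun f => congrArg (QuotientAddGroup.mk (s := eventuallyIn I))
    (funext fun m => add_mul (a m) (b m) (f (g m)))

theorem seqOp_congr {g h : ℕ → ℕ} (hg : Tendsto g atTop atTop) (hh : Tendsto h atTop atTop)
    {a b : ℕ → R} (hab : ∀ᶠ m in atTop, a m = b m) (hgh : ∀ᶠ m in atTop, g m = h m) :
    seqOp I g hg a = seqOp I h hh b := by
  refine seqEnd_ext fun f => QuotientAddGroup.eq.2 ?_
  change ∀ᶠ m in atTop, -(a m * f (g m)) + b m * f (h m) ∈ I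
  filter_upwards [hab, hgh] with m h1 h2
  rw [h1, h2, neg_add_cancel]
  exact I.zero_mem

theorem seqOp_mul {g h : ℕ → ℕ} (hg : Tendsto g atTop atTop) (hh : Tendsto h atTop atTop)
    (a b : ℕ → R) : seqOp I g hg a * seqOp I h hh b =
      seqOp I (fun m => h (g m)) (hh.comp hg) (fun m => a m * b (g m)) :=
  seqEnd_ext fun f => congrArg (QuotientAddGroup.mk (s := eventuallyIn I))
    (funext fun m => (mul_assoc (a m) (b (g m)) (f (h (g m)))).symm)

theorem seqOp_eq_zero_iff {g : ℕ → ℕ} (hg : Tendsto g atTop atTop) (a : ℕ → R) :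
    seqOp I g hg a = 0 ↔ ∀ f : ℕ → R, ∀ᶠ m in atTop, a m * f (g m) ∈ I := by
  refine ⟨fun h f => ?_, fun h => seqEnd_ext fun f => ?_⟩
  · have h1 : QuotientAddGroup.mk (s := eventuallyIn I) (fun m => a m * f (g m)) = 0 := by
      rw [← seqOp_mk I hg, h]; rfl
    exact (QuotientAddGroup.eq_zero_iff _).1 h1
  · exact (QuotientAddGroup.eq_zero_iff (fun m => a m * f (g m))).2 (h f)

/-- The operators `seqOp I g hg a` depend additively on `a`. -/
def seqOpHom (g : ℕ → ℕ) (hg : Tendsto g atTop atTop) :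
    (ℕ → R) →+ AddMonoid.End ((ℕ → R) ⧸ eventuallyIn I) :=
  AddMonoidHom.mk' (seqOp I g hg) (seqOp_add I hg)

variable (α) in
/-- The sequence of iterates `m ↦ α^m(r)`. -/
def iterates : R →+ (ℕ → R) :=
  AddMonoidHom.mk' (fun r m => (α ^ m) r) fun r s => funext fun m => map_add (α ^ m) r s

variable (α) in
theorem iterates_apply_map (r : R) (m : ℕ) : iterates α (α r) m = iterates α r (m + 1) :=
  (congrArg (fun f : R →ₙ+* R => f r) (pow_succ α m)).symm

variable (α) in
theorem iterates_mul (r s : R) (m : ℕ) :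
    iterates α (r * s) m = iterates α r m * iterates α s m :=
  map_mul (α ^ m) r s

variable (α) in
/-- The representation on sequences modulo `I`, in which `r ∈ R` acts at the index `m` as the
multiplication by `α^m(r)`; elements of `P` and `Q` act in the same way, preceded by the shift
`f ↦ f (· + 1)` and followed by the shift `f ↦ f (· - 1)`, respectively. These shifts are inverse
to each other, as sequences are only considered up to finitely many terms. -/
def seqRep : CovariantRep (endoSystem α) (AddMonoid.End ((ℕ → R) ⧸ eventuallyIn I)) where
  S := (seqOpHom I (· + 1) (tendsto_add_atTop_nat 1)).comp
    ((iterates α).comp (endoP α).subtype)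
  T := (seqOpHom I (· - 1) (tendsto_sub_atTop_nat 1)).comp
    (AddMonoidHom.mk' (fun q m => iterates α (q : R) (m - 1)) fun q q' => funext fun m => by
      change iterates α ((q : R) + q') (m - 1) = _
      rw [map_add]; rfl)
  σ := { (seqOpHom I id tendsto_id).comp (iterates α) with
    map_mul' := fun r s => by
      refine Eq.trans ?_ (seqOp_mul I tendsto_id tendsto_id _ _).symm
      exact congrArg (seqOp I id tendsto_id) (funext fun m => iterates_mul α r s m) }
  S_left r p := by
    refine Eq.trans ?_ (seqOp_mul I tendsto_id (tendsto_add_atTop_nat 1) _ _).symm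
    exact congrArg (seqOp I _ (tendsto_add_atTop_nat 1)) (funext fun m => iterates_mul α r p m)
  S_right r p := by
    refine Eq.trans ?_ (seqOp_mul I (tendsto_add_atTop_nat 1) tendsto_id _ _).symm
    refine congrArg (seqOp I _ (tendsto_add_atTop_nat 1)) (funext fun m => ?_)
    change iterates α ((p : R) * α r) m = iterates α (p : R) m * iterates α r (m + 1)
    rw [iterates_mul, iterates_apply_map]
  T_left r q := by
    refine Eq.trans ?_ (seqOp_mul I tendsto_id (tendsto_sub_atTop_nat 1) _ _).symm
    refine seqOp_congr I (tendsto_sub_atTop_nat 1) ((tendsto_sub_atTop_nat 1).comp tendsto_id) ?_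
      (Eventually.of_forall fun _ => rfl)
    filter_upwards [eventually_ge_atTop 1] with m hm
    change iterates α (α r * (q : R)) (m - 1) = iterates α r m * iterates α (q : R) (m - 1)
    rw [iterates_mul, iterates_apply_map, Nat.sub_add_cancel hm]
  T_right r q := by
    refine Eq.trans ?_ (seqOp_mul I (tendsto_sub_atTop_nat 1) tendsto_id _ _).symm
    exact congrArg (seqOp I _ (tendsto_sub_atTop_nat 1))
      (funext fun m => iterates_mul α q r (m - 1))
  σ_psi p q := by
    refine Eq.trans ?_ (seqOp_mul I (tendsto_add_atTop_nat 1) (tendsto_sub_atTop_nat 1) _ _).symm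
    exact congrArg (seqOp I id tendsto_id) (funext fun m => iterates_mul α p q m)

/-- If `Δ(x) = ∑ i, θ_{q i, p i}`, then `α(x) = ∑ i, q i * p i`. -/
theorem map_eq_sum_of_isFiniteRankExpansion (hR : HasLocalUnits R) {x : R} {n : ℕ}
    {q : Fin n → endoQ α} {p : Fin n → endoP α}
    (h : (endoSystem α).IsFiniteRankExpansion x n q p) :
    α x = ∑ i, (q i : R) * (p i : R) := by
  classical
  choose c hc using fun i => endoP_exists_unit hR (p i).2
  obtain ⟨e, he, hu⟩ := hR (insert x (Finset.univ.image c))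
  -- evaluate both sides at `y = α e`, where `e` is a right unit for `x` and all `c i`
  have h1 := congrArg (Subtype.val) (h ⟨α e, AddSubgroup.subset_closure
    ⟨e, α e, by rw [← map_mul, he]⟩⟩)
  rw [AddSubgroup.val_finsetSum] at h1
  calc α x = α x * α e := by rw [← map_mul, (hu x (by simp)).2]
    _ = ∑ i, (q i : R) * ((p i : R) * α e) := h1
    _ = ∑ i, (q i : R) * (p i : R) := Finset.sum_congr rfl fun i _ => by
      rw [hc i e (hu _ (by simp)).2]

theorem isCuntzPimsner_seqRep (hR : HasLocalUnits R) :
    RSystem.IsCuntzPimsner ⊤ (seqRep α I) := by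
  intro x _ n q p h
  have h2 : ∀ i, (seqRep α I).T (q i) * (seqRep α I).S (p i) =
      seqOp I id tendsto_id (fun m => iterates α ((q i : R) * p i) (m - 1)) := fun i => by
    refine (seqOp_mul I (tendsto_sub_atTop_nat 1) (tendsto_add_atTop_nat 1) _ _).trans
      (seqOp_congr I _ tendsto_id ?_ ?_)
    · exact Eventually.of_forall fun m => (iterates_mul α _ _ _).symm
    · filter_upwards [eventually_ge_atTop 1] with m hm using Nat.sub_add_cancel hm
  rw [Finset.sum_congr rfl fun i _ => h2 i]
  refine Eq.trans ?_ (map_sum (seqOpHom I id tendsto_id)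
    (fun i m => iterates α ((q i : R) * p i) (m - 1)) Finset.univ)
  refine seqOp_congr I tendsto_id tendsto_id ?_ (Eventually.of_forall fun _ => rfl)
  filter_upwards [eventually_ge_atTop 1] with m hm
  rw [Finset.sum_apply]
  change iterates α x m = ∑ i, (α ^ (m - 1)) ((q i : R) * p i)
  rw [← map_sum, ← map_eq_sum_of_isFiniteRankExpansion hR h]
  change iterates α x m = iterates α (α x) (m - 1)
  rw [iterates_apply_map, Nat.sub_add_cancel hm]

/-- A strongly invariant ideal `I` is the kernel of the representation of `R` on sequences modulo
`I`, so it is recovered from the ideal that it generates in the Cuntz–Pimsner ring. -/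
theorem comap_span_of_isStronglyInvariant (hR : HasLocalUnits R) (hα : Injective α)
    {I : TwoSidedIdeal R} (hI : IsStronglyInvariant α I) :
    TwoSidedIdeal.comap (endoCPRep α).σ
      (TwoSidedIdeal.span ((endoCPRep α).σ '' (I : Set R))) = I := by
  have hpow : ∀ (m : ℕ) (x : R), iterates α x m ∈ I ↔ x ∈ I := by
    intro m
    induction m with
    | zero => exact fun x => Iff.rfl
    | succ m ih =>
      intro x
      rw [← iterates_apply_map, ih]
      refine ⟨fun hx => ?_, hI.1 x⟩
      obtain ⟨e, -, ⟨h1, h2⟩, -⟩ := hR.exists_unit x x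
      obtain ⟨y, hy, hxy⟩ := hI.2 e e (α x) hx
      rw [← map_mul, ← map_mul, h1, h2] at hxy
      rwa [hα hxy]
  let φ := RSystem.cuntzPimsnerLift (seqRep α I) (isCuntzPimsner_seqRep I hR)
  have hφ : ∀ r, φ ((endoCPRep α).σ r) = seqOp I id tendsto_id (iterates α r) :=
    RSystem.cuntzPimsnerLift_σ _ _
  refine le_antisymm (fun x hx => ?_)
    fun x hx => (TwoSidedIdeal.mem_comap _).2 (TwoSidedIdeal.subset_span ⟨x, hx, rfl⟩)
  have hle : TwoSidedIdeal.span ((endoCPRep α).σ '' (I : Set R)) ≤ TwoSidedIdeal.ker φ := by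
    refine TwoSidedIdeal.span_le.2 ?_
    rintro _ ⟨y, hy, rfl⟩
    rw [SetLike.mem_coe, TwoSidedIdeal.mem_ker, hφ]
    exact (seqOp_eq_zero_iff I _ _).2 fun f => Eventually.of_forall fun m =>
      I.mul_mem_right _ _ ((hpow m y).2 hy)
  have h1 : seqOp I id tendsto_id (iterates α x) = 0 := by
    rw [← hφ]
    exact (TwoSidedIdeal.mem_ker φ).1 (hle ((TwoSidedIdeal.mem_comap _).1 hx))
  -- apply the operator of `x` to the sequence `m ↦ α^m(e)`, where `x e = x`
  obtain ⟨e, -, ⟨-, he⟩, -⟩ := hR.exists_unit x x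
  obtain ⟨m, hm⟩ := ((seqOp_eq_zero_iff I _ _).1 h1 (iterates α e)).exists
  rw [id] at hm
  rwa [← iterates_mul, he, hpow] at hm

end EndoSystem

theorem proposition8p1 {R : Type u} [NonUnitalRing R] (hR : HasLocalUnits R)
    (α : R →ₙ+* R) (hα : Function.Injective α)
    (hcorner : ∀ r s t : R, ∃ y : R, α r * s * α t = α y) :
    ∃ e : {H : TwoSidedIdeal (EndoCPRing α) // (endoCPRep α).IsGradedIdeal H} ≃
        {I : TwoSidedIdeal R // IsStronglyInvariant α I},
      (∀ H, ((e H : TwoSidedIdeal R) : Set R) =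
        {x : R | (endoCPRep α).σ x ∈ (H : TwoSidedIdeal (EndoCPRing α))}) ∧
      (∀ I, (e.symm I : TwoSidedIdeal (EndoCPRing α)) =
        TwoSidedIdeal.span ((endoCPRep α).σ '' ((I : TwoSidedIdeal R) : Set R))) := by
  have hρ : RSystem.IsCuntzPimsner ⊤ (endoCPRep α) :=
    (endoSystem α).isCuntzPimsner_cuntzPimsnerRep ⊤
  have htop : ⨆ n, (endoCPRep α).component n = ⊤ := (endoSystem α).iSup_component_eq_top ⊤
  have hgraded : ∀ I : TwoSidedIdeal R, (endoCPRep α).IsGradedIdeal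
      (TwoSidedIdeal.span ((endoCPRep α).σ '' (I : Set R))) := fun I => by
    refine (endoCPRep α).isGradedIdeal_span
      (RSystem.iSupIndep_component ⊤ fun a => ?_)
      htop ?_
    · obtain ⟨e, -, -, h⟩ := endoRep_exists_idempotent hR htop a
      exact ⟨_, h⟩
    · rintro _ ⟨x, -, rfl⟩
      exact (endoCPRep α).σ_mem_component x
  refine ⟨⟨fun H => ⟨_, isStronglyInvariant_comap hR hρ hcorner H.1⟩,
    fun I => ⟨_, hgraded I.1⟩,
    fun H => Subtype.ext (span_comap_of_isGradedIdeal hR hρ htop hcorner H.2),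
    fun I => Subtype.ext (comap_span_of_isStronglyInvariant hR hα I.2)⟩, fun H => ?_, fun I => rfl⟩
  ext x
  exact TwoSidedIdeal.mem_comap _
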